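/- For integers $N\ge 1$ and $0\le r\le\lfloor N/2\rfloor$ let $G(r,N)$ be the circulant graph with vertices $0,1,\dots,N-1$ in which two distinct vertices $i,j$ are adjacent if and only if $|i-j+xN|\le r$ for some $x\in\mathbb Z$. The energy $\mathcal E(G)$ of a finite graph $G$ is the sum of the absolute values of the eigenvalues of its adjacency matrix, counted with multiplicity, and a graph $G$ with $n$ vertices is called hyperenergetic if $\mathcal E(G)>2(n-1)$. Then: (a) There are only finitely many pairs $(r,N)$ with $r\le 4$, $N\ge 1$ and $r\le\lfloor N/2\rfloor$ for which $G(r,N)$ is hyperenergetic. (b) For each $r\ge 5$ there are only finitely many $N$ with $r\le\lfloor N/2\rfloor$ for which $G(r,N)$ is not hyperenergetic; the graph $G(r,2r+2)$ is one that is not hyperenergetic. -/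

import Mathlib

/-- The adjacency matrix of a graph is a real symmetric matrix. -/
theorem SimpleGraph.isHermitian_adjMatrix_real {V : Type*} (G : SimpleGraph V)
    [DecidableRel G.Adj] : (G.adjMatrix ℝ).IsHermitian := by
  rw [Matrix.IsHermitian, Matrix.conjTranspose_eq_transpose_of_trivial]
  exact G.isSymm_adjMatrix

open Classical in
/-- The energy of a finite graph: the sum of the absolute values of the eigenvalues of its
adjacency matrix, counted with multiplicity. -/
noncomputable def SimpleGraph.energy {V : Type*} [Fintype V] (G : SimpleGraph V) : ℝ :=
  ∑ i : V, |G.isHermitian_adjMatrix_real.eigenvalues i|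

/-- An `n`-vertex graph is hyperenergetic if its energy is larger than `2 (n - 1)`, the energy of
the complete graph on `n` vertices. -/
def SimpleGraph.Hyperenergetic {V : Type*} [Fintype V] (G : SimpleGraph V) : Prop :=
  2 * ((Fintype.card V : ℝ) - 1) < G.energy

/-- The circulant graph `G(r, N)` with vertices `0, …, N - 1`: two distinct vertices `i` and `j`
are adjacent when `|i - j + x N| ≤ r` for some integer `x`. -/
def circG (r N : ℕ) : SimpleGraph (Fin N) where
  Adj i j := i ≠ j ∧ ∃ x : ℤ, |((i : ℕ) : ℤ) - ((j : ℕ) : ℤ) + x * (N : ℤ)| ≤ (r : ℤ)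
  symm := ⟨fun i j h => by
    obtain ⟨hne, x, hx⟩ := h
    refine ⟨hne.symm, -x, ?_⟩
    rw [← abs_neg]
    convert hx using 2
    ring⟩
  loopless := ⟨fun _ h => h.1 rfl⟩

/-! For `2 * r < N` the adjacency matrix is circulant, with eigenvalues f(2πk/N), where f(x) =
∑_{d=1}^r 2 cos(dx) is `circSymbol r`. Hence `circG_energy` writes the energy as a sum of values of
|f|, a Riemann sum: energy/N tends to (1/π) ∫_0^π |f|. Comparison with 2 settles all large N as soon
as I_r = ∫_0^π |f| differs from 2π, and only finitely many N remain.

For r ≤ 4, f is an explicit polynomial in cos x with known sign changes, so I_r is evaluated or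
bounded from the primitive F = `circPrimitive r`, giving I_r < 2π. The case r = 4 is tight: about
6.24 against 6.28.

For r ≥ 5, F(0) = F(π) = 0 gives I_r ≥ 2 F(b) for every b in [0, π]. At b = π/(r+1), the first
positive zero of f, F(b) is a Riemann sum for 2 ∫_0^π (sin t)/t dt ≈ 3.70, as in the Gibbs
phenomenon. A Taylor bound of degree 7 for the sine shows that it already exceeds π from r = 5 on.

The graph with N = 2r+2 is a cocktail party graph: its eigenvalues are 2r, 0 and -2, and its energy
4r is below 2(2r+1). -/

open Filter Topology MeasureTheory

/-! ### Orthogonality of the Hartley kernel -/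

open Finset in
theorem Complex.sum_exp_two_pi_mul_div_eq_zero {N : ℕ} (hN : N ≠ 0) {m : ℤ} (hm : ¬ (N : ℤ) ∣ m) :
    ∑ j ∈ range N, Complex.exp (((2 * Real.pi * j * m / N : ℝ) : ℂ) * Complex.I) = 0 := by
  have hN' : (N : ℂ) ≠ 0 := by exact_mod_cast hN
  set z : ℂ := Complex.exp (2 * Real.pi * m / N * Complex.I) with hz
  have hpow : ∀ j : ℕ,
      Complex.exp (((2 * Real.pi * j * m / N : ℝ) : ℂ) * Complex.I) = z ^ j := by
    intro j
    rw [hz, ← Complex.exp_nat_mul]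
    congr 1
    push_cast
    ring
  have hz1 : z ≠ 1 := by
    intro h
    obtain ⟨n, hn⟩ := Complex.exp_eq_one_iff.1 h
    apply hm
    refine ⟨n, ?_⟩
    have hpi : (2 * Real.pi * Complex.I : ℂ) ≠ 0 := Complex.two_pi_I_ne_zero
    have h2 : (2 * Real.pi * Complex.I : ℂ) * m = (2 * Real.pi * Complex.I) * (N * n) := by
      field_simp at hn
      linear_combination (2 * Real.pi * Complex.I : ℂ) * hn
    have h3 := mul_left_cancel₀ hpi h2
    exact_mod_cast h3
  have hzN : z ^ N = 1 := by
    rw [hz, ← Complex.exp_nat_mul, Complex.exp_eq_one_iff]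
    exact ⟨m, by field_simp⟩
  simp_rw [hpow]
  rw [geom_sum_eq hz1, hzN, sub_self, zero_div]

open Finset in
theorem Real.sum_cos_two_pi_mul_div_eq_zero {N : ℕ} (hN : N ≠ 0) {m : ℤ} (hm : ¬ (N : ℤ) ∣ m) :
    ∑ j ∈ range N, Real.cos (2 * Real.pi * j * m / N) = 0 := by
  have h := congrArg Complex.re (Complex.sum_exp_two_pi_mul_div_eq_zero hN hm)
  simpa only [Complex.re_sum, Complex.exp_ofReal_mul_I_re, Complex.zero_re] using h

open Finset in
theorem Real.sum_sin_two_pi_mul_div_eq_zero {N : ℕ} (hN : N ≠ 0) (m : ℤ) :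
    ∑ j ∈ range N, Real.sin (2 * Real.pi * j * m / N) = 0 := by
  by_cases hm : (N : ℤ) ∣ m
  · obtain ⟨q, rfl⟩ := hm
    have hN' : (N : ℝ) ≠ 0 := by exact_mod_cast hN
    refine sum_eq_zero fun j _ => ?_
    rw [show 2 * Real.pi * j * ((N * q : ℤ) : ℝ) / N = ((2 * j * q : ℤ) : ℝ) * Real.pi by
      push_cast; field_simp]
    exact Real.sin_int_mul_pi _
  · have h := congrArg Complex.im (Complex.sum_exp_two_pi_mul_div_eq_zero hN hm)
    simpa only [Complex.im_sum, Complex.exp_ofReal_mul_I_im, Complex.zero_im] using h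

/-- The function `cos + sin`, the kernel of the Hartley transform. -/
noncomputable def Real.cas (x : ℝ) : ℝ := Real.cos x + Real.sin x

theorem Real.cas_mul_cas (x y : ℝ) :
    Real.cas x * Real.cas y = Real.cos (x - y) + Real.sin (x + y) := by
  simp only [Real.cas, Real.cos_sub, Real.sin_add]
  ring

theorem Real.cas_add_add_cas_sub (x y : ℝ) :
    Real.cas (x + y) + Real.cas (x - y) = Real.cas x * (2 * Real.cos y) := by
  simp only [Real.cas, Real.cos_add, Real.sin_add, Real.cos_sub, Real.sin_sub]
  ring

-- The sine sums vanish for every frequency, so only the cosine of the difference survives. This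
-- gives a real symmetric eigenbasis, with no passage to complex characters.
open Finset in
theorem Real.sum_cas_mul_cas {N : ℕ} (i k : Fin N) :
    ∑ j : Fin N, Real.cas (2 * Real.pi * i * j / N) * Real.cas (2 * Real.pi * j * k / N) =
      if i = k then (N : ℝ) else 0 := by
  have hN : N ≠ 0 := (Fin.pos i).ne'
  have h : ∀ j : ℕ, Real.cas (2 * Real.pi * i * j / N) * Real.cas (2 * Real.pi * j * k / N) =
      Real.cos (2 * Real.pi * j * ((i : ℤ) - (k : ℤ) : ℤ) / N) +
      Real.sin (2 * Real.pi * j * ((i : ℤ) + (k : ℤ) : ℤ) / N) := by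
    intro j
    rw [Real.cas_mul_cas]
    congr 2 <;> push_cast <;> ring
  rw [Fin.sum_univ_eq_sum_range
    (fun j : ℕ => Real.cas (2 * Real.pi * i * j / N) * Real.cas (2 * Real.pi * j * k / N)) N]
  simp_rw [h]
  rw [sum_add_distrib, Real.sum_sin_two_pi_mul_div_eq_zero hN, add_zero]
  split_ifs with hik
  · subst hik
    simp
  · apply Real.sum_cos_two_pi_mul_div_eq_zero hN
    rintro ⟨q, hq⟩
    apply hik
    have hi := i.2
    have hk := k.2
    have hq0 : q = 0 := by
      rcases lt_trichotomy q 0 with h | h | h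
      · nlinarith
      · exact h
      · nlinarith
    subst hq0
    ext
    lia

/-! ### Diagonalization of the circulant graph -/

open Matrix Polynomial in
theorem Matrix.IsHermitian.sum_abs_eigenvalues_eq {V : Type*} [Fintype V] [DecidableEq V]
    {A : Matrix V V ℝ} (hA : A.IsHermitian) (H : Matrix V V ℝ) (d : V → ℝ) {c : ℝ} (hc : c ≠ 0)
    (hH : H * H = c • (1 : Matrix V V ℝ)) (hAH : A * H = H * diagonal d) :
    ∑ i, |hA.eigenvalues i| = ∑ i, |d i| := by
  have h1 : H * (c⁻¹ • H) = 1 := by rw [mul_smul_comm, hH, smul_smul, inv_mul_cancel₀ hc, one_smul]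
  -- A is conjugate to the diagonal matrix, since H is invertible with inverse H/c; equal
  -- characteristic polynomials give equal multisets of eigenvalues.
  have hchar : A.charpoly = (diagonal d).charpoly := by
    have : A = H * (diagonal d * (c⁻¹ • H)) := by
      rw [← mul_assoc, ← hAH, mul_assoc, h1, mul_one]
    rw [this, charpoly_mul_comm, mul_assoc, mul_eq_one_comm.1 h1, mul_one]
  have hroots : Multiset.map hA.eigenvalues Finset.univ.val = Multiset.map d Finset.univ.val := by
    have h2 := hA.roots_charpoly_eq_eigenvalues
    rw [hchar, charpoly_diagonal, Finset.prod_eq_multiset_prod,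
      ← Function.comp_def (fun a => X - C a) d, ← Multiset.map_map,
      Polynomial.roots_multiset_prod_X_sub_C] at h2
    simpa using h2.symm
  have h3 := congrArg (fun s => (Multiset.map (fun x : ℝ => |x|) s).sum) hroots
  simpa [Multiset.map_map] using h3

open Finset in
theorem Int.sum_Icc_erase_zero (φ : ℤ → ℝ) (r : ℕ) :
    ∑ d ∈ (Icc (-(r : ℤ)) r).erase 0, φ d =
      ∑ d ∈ Finset.range r, (φ (((d : ℕ) : ℤ) + 1) + φ (-((d : ℤ) + 1))) := by
  induction r with
  | zero => simp
  | succ r ih =>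
    have h : (Icc (-((r + 1 : ℕ) : ℤ)) ((r + 1 : ℕ) : ℤ)).erase 0 =
        insert ((r : ℤ) + 1) (insert (-((r : ℤ) + 1)) ((Icc (-(r : ℤ)) r).erase 0)) := by
      ext x
      simp only [mem_erase, mem_Icc, mem_insert]
      push_cast
      lia
    rw [h, sum_insert, sum_insert, sum_range_succ, ih]
    · ring
    · simp
    · simp only [mem_erase, mem_Icc, mem_insert]
      lia

open Finset in
theorem Int.sum_fin_ite_dvd_sub {N : ℕ} (hN : N ≠ 0) (φ : ℤ → ℝ)
    (hφ : ∀ m q : ℤ, φ (m + N * q) = φ m) (m : ℤ) :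
    ∑ j : Fin N, (if (N : ℤ) ∣ m - j then φ j else 0) = φ m := by
  have hN0 : (0 : ℤ) < N := by lia
  have h0 := Int.emod_nonneg m hN0.ne'
  have h1 := Int.emod_lt_of_pos m hN0
  have hdm := Int.emod_add_mul_ediv m N
  have hlt : (m % N).toNat < N := by lia
  rw [sum_eq_single (⟨(m % N).toNat, hlt⟩ : Fin N)]
  · have hc : (((m % N).toNat : ℕ) : ℤ) = m % N := Int.toNat_of_nonneg h0
    simp only [hc]
    rw [if_pos ⟨m / N, by lia⟩, ← hφ (m % N) (m / N), hdm]
  · intro j _ hj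
    rw [if_neg]
    rintro ⟨q, hq⟩
    apply hj
    have hj2 := j.2
    ext
    have : (j : ℤ) = m % N := by
      rw [show m = j + N * q by lia, Int.add_mul_emod_self_left,
        Int.emod_eq_of_lt (by lia) (by exact_mod_cast hj2)]
    simp only
    lia
  · simp

-- Since 2r < N, the shifts by ±1, …, ±r are distinct and nonzero modulo N, so each neighbour is
-- reached exactly once.
open Finset Classical in
theorem circG_sum_ite_adj {r N : ℕ} (hr : 2 * r < N) (φ : ℤ → ℝ)
    (hφ : ∀ m q : ℤ, φ (m + N * q) = φ m) (i : Fin N) :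
    ∑ j : Fin N, (if (circG r N).Adj i j then φ j else 0) =
      ∑ d ∈ Finset.range r, (φ (i + (((d : ℕ) : ℤ) + 1)) + φ (i - ((d : ℤ) + 1))) := by
  have hN : N ≠ 0 := by lia
  have h1 : ∀ j : Fin N, (if (circG r N).Adj i j then φ j else 0) =
      ∑ d ∈ (Icc (-(r : ℤ)) r).erase 0, (if (N : ℤ) ∣ i + d - j then φ j else 0) := by
    intro j
    split_ifs with hadj
    · obtain ⟨hne, x, hx⟩ := hadj
      have hx := abs_le.1 hx
      have hij : ((i : ℕ) : ℤ) ≠ (j : ℕ) := fun h => hne (Fin.ext (by exact_mod_cast h))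
      rw [sum_eq_single (j - i - x * N : ℤ)]
      · rw [if_pos ⟨-x, by ring⟩]
      · intro d hd hdne
        rw [if_neg]
        rintro ⟨q, hq⟩
        apply hdne
        simp only [mem_erase, mem_Icc] at hd
        have hqx : q = -x := by
          rcases lt_trichotomy (q + x) 0 with h | h | h
          · nlinarith
          · lia
          · nlinarith
        subst hqx
        linarith
      · intro hd
        exfalso
        apply hd
        simp only [mem_erase, mem_Icc]
        refine ⟨fun h0 => hij ?_, by linarith, by linarith⟩
        have hi := i.2
        have hj := j.2
        have hx0 : x = 0 := by
          rcases lt_trichotomy x 0 with h | h | h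
          · nlinarith
          · exact h
          · nlinarith
        subst hx0
        linarith
    · symm
      refine sum_eq_zero fun d hd => if_neg ?_
      rintro ⟨q, hq⟩
      simp only [mem_erase, mem_Icc] at hd
      refine hadj ⟨?_, -q, ?_⟩
      · rintro rfl
        have hq0 : q = 0 := by
          rcases lt_trichotomy q 0 with h | h | h
          · nlinarith
          · exact h
          · nlinarith
        subst hq0
        exact hd.1 (by linarith)
      · rw [abs_le]
        constructor <;> nlinarith
  simp_rw [h1]
  rw [sum_comm]
  simp_rw [Int.sum_fin_ite_dvd_sub hN φ hφ]
  rw [Int.sum_Icc_erase_zero (fun d => φ (i + d))]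
  simp only [sub_eq_add_neg]

/-- The trigonometric polynomial `∑_{0 < |j| ≤ r} exp (i j x)`. -/
noncomputable def circSymbol (r : ℕ) (x : ℝ) : ℝ :=
  ∑ d ∈ Finset.range r, 2 * Real.cos (((d : ℝ) + 1) * x)

open Matrix in
theorem circG_energy {r N : ℕ} (hr : 2 * r < N) :
    (circG r N).energy = ∑ k ∈ Finset.range N, |circSymbol r (2 * Real.pi * k / N)| := by
  classical
  have hN : (N : ℝ) ≠ 0 := by
    have : N ≠ 0 := by lia
    exact_mod_cast this
  rw [← Fin.sum_univ_eq_sum_range (fun k => |circSymbol r (2 * Real.pi * k / N)|) N]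
  rw [SimpleGraph.energy]
  refine Matrix.IsHermitian.sum_abs_eigenvalues_eq
    (circG r N).isHermitian_adjMatrix_real
    (Matrix.of fun i k : Fin N => Real.cas (2 * Real.pi * i * k / N))
    (fun k => circSymbol r (2 * Real.pi * k / N)) hN ?_ ?_
  · ext i k
    simp only [mul_apply, of_apply, Matrix.smul_apply, one_apply, smul_eq_mul, mul_ite, mul_one, mul_zero]
    rw [Real.sum_cas_mul_cas]
  · ext i k
    rw [mul_diagonal, mul_apply]
    simp only [of_apply, SimpleGraph.adjMatrix_apply, ite_mul, one_mul, zero_mul]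
    have h := circG_sum_ite_adj hr (fun m : ℤ => Real.cas (2 * Real.pi * m * k / N)) (by
      intro m q
      have : 2 * Real.pi * ((m + N * q : ℤ) : ℝ) * k / N =
          2 * Real.pi * m * k / N + ((q * k : ℤ) : ℝ) * (2 * Real.pi) := by
        push_cast
        field_simp
      simp only [this, Real.cas, Real.cos_add_int_mul_two_pi, Real.sin_add_int_mul_two_pi]) i
    simp only [Int.cast_natCast] at h
    rw [circSymbol, Finset.mul_sum]
    convert h using 2 with d hd
    rw [← Real.cas_add_add_cas_sub]
    push_cast
    congr 2 <;> ring

/-! ### Riemann sums and the limit of energy / N -/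

theorem LipschitzWith.abs_riemannSum_sub_integral_le {g : ℝ → ℝ} {C : NNReal} (hg : LipschitzWith C g)
    {w : ℝ} (hw : 0 ≤ w) (N : ℕ) :
    |∑ k ∈ Finset.range N, w * g (w * k) - ∫ x in (0 : ℝ)..(w * N), g x| ≤ N * (C * w * w) := by
  have hint : ∀ a b : ℝ, IntervalIntegrable g volume a b := fun a b =>
    hg.continuous.intervalIntegrable a b
  have h1 : ∫ x in (0 : ℝ)..(w * N), g x =
      ∑ k ∈ Finset.range N, ∫ x in (w * k)..(w * (k + 1 : ℕ)), g x := by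
    rw [intervalIntegral.sum_integral_adjacent_intervals (a := fun k : ℕ => w * k)
      fun k _ => hint _ _]
    simp
  rw [h1, ← Finset.sum_sub_distrib]
  refine (Finset.abs_sum_le_sum_abs _ _).trans ?_
  refine (Finset.sum_le_card_nsmul _ _ (C * w * w) fun k _ => ?_).trans_eq (by simp)
  have hlen : w * ((k + 1 : ℕ) : ℝ) - w * k = w := by push_cast; ring
  have h2 : w * g (w * k) = ∫ x in (w * k)..(w * (k + 1 : ℕ)), g (w * k) := by
    rw [intervalIntegral.integral_const, hlen, smul_eq_mul]
  rw [h2, ← intervalIntegral.integral_sub (by simp) (hint _ _)]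
  have hle : w * k ≤ w * ((k + 1 : ℕ) : ℝ) := by linarith
  refine (intervalIntegral.norm_integral_le_of_norm_le_const
    (f := fun x => g (w * k) - g x) (C := C * w) ?_).trans_eq ?_
  · intro x hx
    rw [Set.uIoc_of_le hle] at hx
    rw [← dist_eq_norm]
    refine (hg.dist_le_mul _ _).trans ?_
    gcongr
    rw [dist_comm, Real.dist_eq, abs_of_pos (by linarith [hx.1])]
    linarith [hx.2]
  · rw [hlen, abs_of_nonneg hw]

theorem LipschitzWith.tendsto_riemannSum {g : ℝ → ℝ} {C : NNReal} (hg : LipschitzWith C g)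
    {L : ℝ} (hL : 0 ≤ L) :
    Tendsto (fun N : ℕ => L / N * ∑ k ∈ Finset.range N, g (L * k / N)) atTop
      (𝓝 (∫ x in (0 : ℝ)..L, g x)) := by
  rw [tendsto_iff_dist_tendsto_zero]
  refine squeeze_zero' (Eventually.of_forall fun _ => dist_nonneg) ?_
    (tendsto_const_div_atTop_nhds_zero_nat (C * L * L))
  filter_upwards [eventually_gt_atTop 0] with N hN
  have hN' : (0 : ℝ) < N := by exact_mod_cast hN
  have h := hg.abs_riemannSum_sub_integral_le (w := L / N) (by positivity) N
  rw [div_mul_cancel₀ _ hN'.ne', ← Finset.mul_sum] at h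
  rw [Real.dist_eq]
  convert h using 1
  · simp only [mul_div_right_comm]
  · field_simp

theorem circSymbol_continuous (r : ℕ) : Continuous (circSymbol r) := by
  unfold circSymbol
  fun_prop

theorem circSymbol_lipschitz (r : ℕ) : ∃ C : NNReal, LipschitzWith C fun x => |circSymbol r x| := by
  have h : ∃ C : NNReal, LipschitzWith C (circSymbol r) := by
    induction r with
    | zero => exact ⟨0, LipschitzWith.of_dist_le_mul fun x y => by simp [circSymbol]⟩
    | succ r ih =>
      obtain ⟨C, hC⟩ := ih
      have h1 : LipschitzWith (2 * (r + 1)) fun x : ℝ => 2 * Real.cos (((r : ℝ) + 1) * x) := by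
        refine LipschitzWith.of_dist_le_mul fun x y => ?_
        rw [Real.dist_eq, ← mul_sub, abs_mul, abs_two]
        have h2 := Real.lipschitzWith_cos.dist_le_mul (((r : ℝ) + 1) * x) (((r : ℝ) + 1) * y)
        rw [Real.dist_eq, Real.dist_eq, ← mul_sub, abs_mul,
          abs_of_pos (by positivity : (0 : ℝ) < r + 1)] at h2
        rw [Real.dist_eq]
        push_cast at h2 ⊢
        linarith
      refine ⟨C + 2 * (r + 1), ?_⟩
      have h3 := hC.add h1
      have h4 : circSymbol (r + 1) =
          fun x => circSymbol r x + 2 * Real.cos (((r : ℝ) + 1) * x) :=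
        funext fun x => by rw [circSymbol, Finset.sum_range_succ, ← circSymbol]
      rwa [h4]
  obtain ⟨C, hC⟩ := h
  refine ⟨1 * C, LipschitzWith.comp (g := circSymbol r) (f := fun x : ℝ => |x|) ?_ hC⟩
  exact LipschitzWith.of_dist_le_mul fun x y => by
    simpa [Real.dist_eq] using abs_abs_sub_abs_le x y

theorem circSymbol_two_pi_sub (r : ℕ) (x : ℝ) :
    circSymbol r (2 * Real.pi - x) = circSymbol r x := by
  refine Finset.sum_congr rfl fun d _ => ?_
  have h : ((d : ℝ) + 1) * (2 * Real.pi - x) =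
      ((d + 1 : ℕ) : ℝ) * (2 * Real.pi) - ((d : ℝ) + 1) * x := by
    push_cast
    ring
  rw [h, Real.cos_nat_mul_two_pi_sub]

theorem integral_abs_circSymbol_two_pi (r : ℕ) :
    ∫ x in (0 : ℝ)..(2 * Real.pi), |circSymbol r x| =
      2 * ∫ x in (0 : ℝ)..Real.pi, |circSymbol r x| := by
  have hint : ∀ a b : ℝ, IntervalIntegrable (fun x => |circSymbol r x|) volume a b := fun a b =>
    (circSymbol_continuous r).abs.intervalIntegrable a b
  rw [← intervalIntegral.integral_add_adjacent_intervals (hint 0 Real.pi) (hint _ _)]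
  have h := intervalIntegral.integral_comp_sub_left (a := 0) (b := Real.pi)
    (fun x => |circSymbol r x|) (2 * Real.pi)
  simp only [circSymbol_two_pi_sub] at h
  rw [h, show 2 * Real.pi - Real.pi = Real.pi by ring, sub_zero]
  ring

theorem circG_energy_tendsto (r : ℕ) :
    Tendsto (fun N : ℕ => (circG r N).energy / N) atTop
      (𝓝 ((∫ x in (0 : ℝ)..Real.pi, |circSymbol r x|) / Real.pi)) := by
  obtain ⟨C, hC⟩ := circSymbol_lipschitz r
  have h := hC.tendsto_riemannSum Real.two_pi_pos.le
  rw [integral_abs_circSymbol_two_pi] at h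
  have h2 := h.div_const (2 * Real.pi)
  have hpi := Real.pi_pos
  rw [mul_div_mul_left _ _ two_ne_zero] at h2
  refine h2.congr' ?_
  filter_upwards [eventually_gt_atTop (2 * r)] with N hN
  rw [circG_energy hN]
  field_simp

theorem eventually_hyperenergetic {r : ℕ}
    (h : 2 * Real.pi < ∫ x in (0 : ℝ)..Real.pi, |circSymbol r x|) :
    ∀ᶠ N in atTop, (circG r N).Hyperenergetic := by
  have hlim : 2 < (∫ x in (0 : ℝ)..Real.pi, |circSymbol r x|) / Real.pi := by
    rwa [lt_div_iff₀ Real.pi_pos]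
  filter_upwards [(circG_energy_tendsto r).eventually_const_lt hlim, eventually_gt_atTop 0]
    with N hN hN0
  have hN' : (0 : ℝ) < N := by exact_mod_cast hN0
  rw [lt_div_iff₀ hN'] at hN
  rw [SimpleGraph.Hyperenergetic, Fintype.card_fin]
  linarith

theorem eventually_not_hyperenergetic {r : ℕ}
    (h : ∫ x in (0 : ℝ)..Real.pi, |circSymbol r x| < 2 * Real.pi) :
    ∀ᶠ N in atTop, ¬ (circG r N).Hyperenergetic := by
  -- The extra 0 is the limit of 2/N, which absorbs the -2 in the threshold 2(N - 1).
  have hlim : (∫ x in (0 : ℝ)..Real.pi, |circSymbol r x|) / Real.pi + 0 < 2 := by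
    rwa [add_zero, div_lt_iff₀ Real.pi_pos]
  filter_upwards [((circG_energy_tendsto r).add
    (tendsto_const_div_atTop_nhds_zero_nat 2)).eventually_lt_const hlim, eventually_gt_atTop 0]
    with N hN hN0
  have hN' : (0 : ℝ) < N := by exact_mod_cast hN0
  rw [← add_div, div_lt_iff₀ hN'] at hN
  rw [SimpleGraph.Hyperenergetic, Fintype.card_fin]
  linarith

/-! ### The Dirichlet kernel and the graph with N = 2r + 2 -/

theorem circSymbol_mul_sin (r : ℕ) (x : ℝ) :
    circSymbol r x * Real.sin (x / 2) = Real.sin ((2 * r + 1) * (x / 2)) - Real.sin (x / 2) := by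
  induction r with
  | zero => simp [circSymbol]
  | succ r ih =>
    have h := Real.two_mul_sin_mul_cos (x / 2) (((r : ℝ) + 1) * x)
    rw [show x / 2 - ((r : ℝ) + 1) * x = -((2 * r + 1) * (x / 2)) by ring, Real.sin_neg,
      show x / 2 + ((r : ℝ) + 1) * x = (2 * (r + 1 : ℕ) + 1) * (x / 2) by push_cast; ring] at h
    rw [circSymbol, Finset.sum_range_succ, ← circSymbol]
    linarith

theorem circSymbol_pi_mul_div {r k : ℕ} (hk : 0 < k) (hkr : k < 2 * r + 2) :
    circSymbol r (2 * Real.pi * k / (2 * r + 2 : ℕ)) = -(1 + (-1) ^ k) := by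
  have hk' : (0 : ℝ) < k := by exact_mod_cast hk
  have hkr' : (k : ℝ) < 2 * r + 2 := by exact_mod_cast hkr
  have hpi := Real.pi_pos
  set y : ℝ := 2 * Real.pi * k / (2 * r + 2 : ℕ) with hy
  have hy2 : y / 2 = Real.pi * (k / (2 * r + 2)) := by
    rw [hy]
    push_cast
    field_simp
  have hsin : 0 < Real.sin (y / 2) := by
    rw [hy2]
    apply Real.sin_pos_of_pos_of_lt_pi (by positivity)
    have : (k : ℝ) / (2 * r + 2) < 1 := by rw [div_lt_one (by positivity)]; exact hkr'
    nlinarith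
  have h := circSymbol_mul_sin r y
  -- For this N, (2r + 2)(y/2) = kπ, so both sines in the Dirichlet kernel formula are multiples of
  -- sin(y/2).
  have harg : (2 * (r : ℝ) + 1) * (y / 2) = k * Real.pi - y / 2 := by
    rw [hy2]
    field_simp
    ring
  rw [harg, Real.sin_sub, Real.sin_nat_mul_pi, Real.cos_nat_mul_pi] at h
  apply mul_right_cancel₀ hsin.ne'
  linarith

theorem circG_energy_two_mul_add_two (r : ℕ) : (circG r (2 * r + 2)).energy = 4 * r := by
  rw [circG_energy (by lia), Finset.sum_range_succ']
  have h : ∀ k ∈ Finset.range (2 * r + 1),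
      |circSymbol r (2 * Real.pi * (k + 1 : ℕ) / (2 * r + 2 : ℕ))| = 1 + (-1) ^ (k + 1) := by
    intro k hk
    rw [Finset.mem_range] at hk
    rw [circSymbol_pi_mul_div (by lia) (by lia), abs_neg]
    rcases neg_one_pow_eq_or ℝ (k + 1) with h | h <;> rw [h] <;> norm_num
  have h0 : |circSymbol r (2 * Real.pi * (0 : ℕ) / (2 * r + 2 : ℕ))| = 2 * r := by
    simp [circSymbol, mul_comm]
  rw [Finset.sum_congr rfl h, h0, Finset.sum_add_distrib]
  have h1 : ∑ k ∈ Finset.range (2 * r + 1), (-1 : ℝ) ^ (k + 1) = -1 := by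
    simp_rw [pow_succ, ← Finset.sum_mul]
    rw [neg_one_geom_sum, if_neg (by simp)]
    norm_num
  rw [h1]
  simp
  ring

theorem circG_not_hyperenergetic_two_mul_add_two (r : ℕ) :
    ¬ (circG r (2 * r + 2)).Hyperenergetic := by
  rw [SimpleGraph.Hyperenergetic, Fintype.card_fin, circG_energy_two_mul_add_two]
  push_cast
  linarith

/-! ### The primitive and the integral of |f| -/

/-- The antiderivative of `circSymbol r` vanishing at `0`. -/
noncomputable def circPrimitive (r : ℕ) (x : ℝ) : ℝ :=
  ∑ d ∈ Finset.range r, 2 * Real.sin (((d : ℝ) + 1) * x) / ((d : ℝ) + 1)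

theorem circPrimitive_hasDerivAt (r : ℕ) (x : ℝ) :
    HasDerivAt (circPrimitive r) (circSymbol r x) x := by
  unfold circPrimitive circSymbol
  refine HasDerivAt.fun_sum fun d _ => ?_
  have hd : (d : ℝ) + 1 ≠ 0 := by positivity
  have h := ((((hasDerivAt_id x).const_mul ((d : ℝ) + 1)).sin).const_mul 2).div_const ((d : ℝ) + 1)
  refine h.congr_deriv ?_
  simp only [id]
  field_simp

theorem integral_circSymbol (r : ℕ) (a b : ℝ) :
    ∫ x in a..b, circSymbol r x = circPrimitive r b - circPrimitive r a :=
  intervalIntegral.integral_eq_sub_of_hasDerivAt (fun x _ => circPrimitive_hasDerivAt r x)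
    ((circSymbol_continuous r).intervalIntegrable a b)

theorem circPrimitive_zero (r : ℕ) : circPrimitive r 0 = 0 := by
  simp [circPrimitive]

theorem circPrimitive_pi (r : ℕ) : circPrimitive r Real.pi = 0 := by
  refine Finset.sum_eq_zero fun d _ => ?_
  have h := Real.sin_nat_mul_pi (d + 1)
  push_cast at h
  rw [h, mul_zero, zero_div]

theorem integral_abs_circSymbol_add (r : ℕ) (a b c : ℝ) :
    ∫ x in a..c, |circSymbol r x| =
      (∫ x in a..b, |circSymbol r x|) + ∫ x in b..c, |circSymbol r x| :=
  (intervalIntegral.integral_add_adjacent_intervals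
    ((circSymbol_continuous r).abs.intervalIntegrable _ _)
    ((circSymbol_continuous r).abs.intervalIntegrable _ _)).symm

/-- The sign condition is phrased through cos x because f is a polynomial in cos x and cosine
decreases on [0, π]. -/
theorem integral_abs_circSymbol_of_nonneg {r : ℕ} {a b : ℝ} (hab : a ≤ b) (ha : 0 ≤ a)
    (hb : b ≤ Real.pi)
    (h : ∀ x, Real.cos b ≤ Real.cos x → Real.cos x ≤ Real.cos a → 0 ≤ circSymbol r x) :
    ∫ x in a..b, |circSymbol r x| = circPrimitive r b - circPrimitive r a := by
  rw [← integral_circSymbol]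
  refine intervalIntegral.integral_congr fun x hx => ?_
  rw [Set.uIcc_of_le hab] at hx
  exact abs_of_nonneg (h x
    (Real.cos_le_cos_of_nonneg_of_le_pi (ha.trans hx.1) hb hx.2)
    (Real.cos_le_cos_of_nonneg_of_le_pi ha (hx.2.trans hb) hx.1))

theorem integral_abs_circSymbol_of_nonpos {r : ℕ} {a b : ℝ} (hab : a ≤ b) (ha : 0 ≤ a)
    (hb : b ≤ Real.pi)
    (h : ∀ x, Real.cos b ≤ Real.cos x → Real.cos x ≤ Real.cos a → circSymbol r x ≤ 0) :
    ∫ x in a..b, |circSymbol r x| = circPrimitive r a - circPrimitive r b := by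
  rw [← neg_sub, ← integral_circSymbol, ← intervalIntegral.integral_neg]
  refine intervalIntegral.integral_congr fun x hx => ?_
  rw [Set.uIcc_of_le hab] at hx
  exact abs_of_nonpos (h x
    (Real.cos_le_cos_of_nonneg_of_le_pi (ha.trans hx.1) hb hx.2)
    (Real.cos_le_cos_of_nonneg_of_le_pi ha (hx.2.trans hb) hx.1))

/-- The integrals of f over [0, b] and [b, π] are F(b) and -F(b); the triangle inequality applies to
each. -/
theorem two_mul_circPrimitive_le_integral_abs {r : ℕ} {b : ℝ} (h0 : 0 ≤ b) (h1 : b ≤ Real.pi) :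
    2 * circPrimitive r b ≤ ∫ x in (0 : ℝ)..Real.pi, |circSymbol r x| := by
  have h2 := (le_abs_self _).trans
    (intervalIntegral.abs_integral_le_integral_abs (f := circSymbol r) (μ := volume) h0)
  have h3 := (neg_le_abs _).trans
    (intervalIntegral.abs_integral_le_integral_abs (f := circSymbol r) (μ := volume) h1)
  rw [integral_circSymbol, circPrimitive_zero] at h2
  rw [integral_circSymbol, circPrimitive_pi] at h3
  rw [integral_abs_circSymbol_add r 0 b Real.pi]
  linarith

/-! ### The cases r ≤ 4 -/

theorem circSymbol_one (x : ℝ) : circSymbol 1 x = 2 * Real.cos x := by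
  simp [circSymbol]

theorem circSymbol_two (x : ℝ) :
    circSymbol 2 x = 2 * ((2 * Real.cos x - 1) * (Real.cos x + 1)) := by
  rw [circSymbol, Finset.sum_range_succ, ← circSymbol, circSymbol_one]
  norm_num [Real.cos_two_mul]
  ring

theorem circSymbol_three (x : ℝ) :
    circSymbol 3 x = 2 * ((2 * Real.cos x ^ 2 - 1) * (2 * Real.cos x + 1)) := by
  rw [circSymbol, Finset.sum_range_succ, ← circSymbol, circSymbol_two]
  norm_num [Real.cos_three_mul]
  ring

theorem circSymbol_four (x : ℝ) :
    circSymbol 4 x = 4 * (Real.cos x * (Real.cos x + 1) *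
      (4 * Real.cos x ^ 2 - 2 * Real.cos x - 1)) := by
  rw [circSymbol, Finset.sum_range_succ, ← circSymbol, circSymbol_three,
    show (((3 : ℕ) : ℝ) + 1) * x = 2 * (2 * x) by push_cast; ring, Real.cos_two_mul,
    Real.cos_two_mul]
  ring

theorem circPrimitive_four (x : ℝ) : circPrimitive 4 x =
    2 * Real.sin x + Real.sin (2 * x) + 2 / 3 * Real.sin (3 * x) + 1 / 2 * Real.sin (4 * x) := by
  norm_num [circPrimitive, Finset.sum_range_succ]
  ring

theorem circPrimitive_three (x : ℝ) : circPrimitive 3 x =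
    2 * Real.sin x + Real.sin (2 * x) + 2 / 3 * Real.sin (3 * x) := by
  norm_num [circPrimitive, Finset.sum_range_succ]
  ring

theorem circPrimitive_two (x : ℝ) : circPrimitive 2 x = 2 * Real.sin x + Real.sin (2 * x) := by
  norm_num [circPrimitive, Finset.sum_range_succ]

theorem circPrimitive_one (x : ℝ) : circPrimitive 1 x = 2 * Real.sin x := by
  norm_num [circPrimitive]

theorem integral_abs_circSymbol_one_lt :
    ∫ x in (0 : ℝ)..Real.pi, |circSymbol 1 x| < 2 * Real.pi := by
  have hpi := Real.pi_gt_three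
  rw [integral_abs_circSymbol_add 1 0 (Real.pi / 2) Real.pi,
    integral_abs_circSymbol_of_nonneg (by linarith) le_rfl (by linarith) fun x h1 _ => by
      rw [Real.cos_pi_div_two] at h1
      rw [circSymbol_one]
      linarith,
    integral_abs_circSymbol_of_nonpos (by linarith) (by linarith) le_rfl fun x _ h1 => by
      rw [Real.cos_pi_div_two] at h1
      rw [circSymbol_one]
      linarith,
    circPrimitive_zero, circPrimitive_pi, circPrimitive_one, Real.sin_pi_div_two]
  linarith

theorem integral_abs_circSymbol_two_lt :
    ∫ x in (0 : ℝ)..Real.pi, |circSymbol 2 x| < 2 * Real.pi := by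
  have hpi := Real.pi_gt_three
  rw [integral_abs_circSymbol_add 2 0 (Real.pi / 3) Real.pi,
    integral_abs_circSymbol_of_nonneg (by linarith) le_rfl (by linarith) fun x h1 _ => by
      rw [Real.cos_pi_div_three] at h1
      rw [circSymbol_two]
      have := mul_nonneg (by linarith : 0 ≤ 2 * Real.cos x - 1)
        (by linarith : 0 ≤ Real.cos x + 1)
      linarith,
    integral_abs_circSymbol_of_nonpos (by linarith) (by linarith) le_rfl fun x h0 h1 => by
      rw [Real.cos_pi_div_three] at h1
      rw [circSymbol_two]
      have := mul_nonneg (by linarith : 0 ≤ 1 - 2 * Real.cos x)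
        (by linarith [Real.neg_one_le_cos x] : 0 ≤ Real.cos x + 1)
      linarith,
    circPrimitive_zero, circPrimitive_pi, circPrimitive_two]
  have h1 := Real.sin_le_one (Real.pi / 3)
  have h2 := Real.sin_le_one (2 * (Real.pi / 3))
  linarith

theorem integral_abs_circSymbol_three_lt :
    ∫ x in (0 : ℝ)..Real.pi, |circSymbol 3 x| < 2 * Real.pi := by
  have hpi := Real.pi_gt_three
  have hs0 := Real.sqrt_nonneg 2
  have hs : √2 * √2 = 2 := Real.mul_self_sqrt (by norm_num)
  have hs1 : √2 < 1.415 := by rw [Real.sqrt_lt' (by norm_num)]; norm_num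
  have hs2 : 1.414 < √2 := by rw [Real.lt_sqrt (by norm_num)]; norm_num
  have ht1 : 1.73 < √3 := by rw [Real.lt_sqrt (by norm_num)]; norm_num
  have e2 : 2 * Real.pi / 3 = Real.pi - Real.pi / 3 := by ring
  have e3 : 3 * Real.pi / 4 = Real.pi - Real.pi / 4 := by ring
  have c2 : Real.cos (2 * Real.pi / 3) = -(1 / 2) := by
    rw [e2, Real.cos_pi_sub, Real.cos_pi_div_three]
  have c3 : Real.cos (3 * Real.pi / 4) = -(√2 / 2) := by
    rw [e3, Real.cos_pi_sub, Real.cos_pi_div_four]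
  have F1 : circPrimitive 3 (Real.pi / 4) = 4 / 3 * √2 + 1 := by
    rw [circPrimitive_three, show 2 * (Real.pi / 4) = Real.pi / 2 by ring,
      show 3 * (Real.pi / 4) = Real.pi - Real.pi / 4 by ring, Real.sin_pi_sub,
      Real.sin_pi_div_four, Real.sin_pi_div_two]
    ring
  have F2 : circPrimitive 3 (2 * Real.pi / 3) = √3 / 2 := by
    rw [circPrimitive_three, show 2 * (2 * Real.pi / 3) = Real.pi / 3 + Real.pi by ring,
      show 3 * (2 * Real.pi / 3) = 2 * Real.pi by ring, Real.sin_add_pi, e2, Real.sin_pi_sub,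
      Real.sin_pi_div_three, Real.sin_two_pi]
    ring
  have F3 : circPrimitive 3 (3 * Real.pi / 4) = 4 / 3 * √2 - 1 := by
    rw [circPrimitive_three,
      show 2 * (3 * Real.pi / 4) = Real.pi / 2 + Real.pi by ring,
      show 3 * (3 * Real.pi / 4) = Real.pi / 4 + 2 * Real.pi by ring, Real.sin_add_pi, e3,
      Real.sin_pi_sub, Real.sin_add_two_pi, Real.sin_pi_div_four, Real.sin_pi_div_two]
    ring
  rw [integral_abs_circSymbol_add 3 0 (Real.pi / 4) Real.pi,
    integral_abs_circSymbol_add 3 (Real.pi / 4) (2 * Real.pi / 3) Real.pi,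
    integral_abs_circSymbol_add 3 (2 * Real.pi / 3) (3 * Real.pi / 4) Real.pi,
    integral_abs_circSymbol_of_nonneg (a := 0) (by linarith) le_rfl (by linarith) fun x h1 _ => by
      rw [Real.cos_pi_div_four] at h1
      rw [circSymbol_three]
      have h2 : 0 ≤ 2 * Real.cos x ^ 2 - 1 := by nlinarith
      have := mul_nonneg h2 (by linarith : 0 ≤ 2 * Real.cos x + 1)
      linarith,
    integral_abs_circSymbol_of_nonpos (a := Real.pi / 4) (by linarith) (by linarith) (by linarith)
      fun x h0 h1 => by
      rw [Real.cos_pi_div_four] at h1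
      rw [c2] at h0
      rw [circSymbol_three]
      have h2 : 0 ≤ 1 - 2 * Real.cos x ^ 2 := by nlinarith
      have := mul_nonneg h2 (by linarith : 0 ≤ 2 * Real.cos x + 1)
      linarith,
    integral_abs_circSymbol_of_nonneg (a := 2 * Real.pi / 3) (by linarith) (by linarith)
      (by linarith) fun x h0 h1 => by
      rw [c2] at h1
      rw [c3] at h0
      rw [circSymbol_three]
      have h2 : 0 ≤ 1 - 2 * Real.cos x ^ 2 := by nlinarith
      have := mul_nonneg h2 (by linarith : 0 ≤ -(2 * Real.cos x + 1))
      linarith,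
    integral_abs_circSymbol_of_nonpos (a := 3 * Real.pi / 4) (by linarith) (by linarith) le_rfl
      fun x h0 h1 => by
      rw [c3] at h1
      rw [circSymbol_three]
      have h2 : 0 ≤ 2 * Real.cos x ^ 2 - 1 := by nlinarith
      have := mul_nonneg h2 (by linarith : 0 ≤ -(2 * Real.cos x + 1))
      linarith,
    circPrimitive_zero, circPrimitive_pi, F1, F2, F3]
  linarith

theorem integral_abs_circSymbol_four_lt :
    ∫ x in (0 : ℝ)..Real.pi, |circSymbol 4 x| < 2 * Real.pi := by
  have hpi := Real.pi_gt_d2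
  have hs : √5 * √5 = 5 := Real.mul_self_sqrt (by norm_num)
  have hs1 : √5 < 2.2361 := by rw [Real.sqrt_lt' (by norm_num)]; norm_num
  have hs2 : 2.236 < √5 := by rw [Real.lt_sqrt (by norm_num)]; norm_num
  have c1 := Real.cos_pi_div_five
  set s := Real.sin (Real.pi / 5)
  have hs0 : 0 < s := Real.sin_pos_of_pos_of_lt_pi (by linarith) (by linarith)
  have hss : s ^ 2 = 1 - ((1 + √5) / 4) ^ 2 := by
    rw [← c1]
    linarith [Real.sin_sq_add_cos_sq (Real.pi / 5)]
  have hs3 : s < 0.588 := by nlinarith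
  have s2 : Real.sin (2 * Real.pi / 5) = 2 * s * ((1 + √5) / 4) := by
    rw [mul_div_assoc, Real.sin_two_mul, c1]
  have c2 : Real.cos (2 * Real.pi / 5) = (√5 - 1) / 4 := by
    rw [mul_div_assoc, Real.cos_two_mul, c1]
    linarith
  have c3 : Real.cos (3 * Real.pi / 5) = -((√5 - 1) / 4) := by
    rw [show 3 * Real.pi / 5 = Real.pi - 2 * Real.pi / 5 by ring, Real.cos_pi_sub, c2]
  have F1 : circPrimitive 4 (Real.pi / 5) = 5 / 2 * s + 5 / 3 * Real.sin (2 * Real.pi / 5) := by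
    rw [circPrimitive_four, show 2 * (Real.pi / 5) = 2 * Real.pi / 5 by ring,
      show 3 * (Real.pi / 5) = Real.pi - 2 * Real.pi / 5 by ring,
      show 4 * (Real.pi / 5) = Real.pi - Real.pi / 5 by ring, Real.sin_pi_sub, Real.sin_pi_sub]
    ring
  have F2 : circPrimitive 4 (Real.pi / 2) = 4 / 3 := by
    rw [circPrimitive_four, show 2 * (Real.pi / 2) = Real.pi by ring,
      show 3 * (Real.pi / 2) = Real.pi / 2 + Real.pi by ring,
      show 4 * (Real.pi / 2) = 2 * Real.pi by ring, Real.sin_add_pi, Real.sin_pi,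
      Real.sin_two_pi, Real.sin_pi_div_two]
    norm_num
  have F3 : circPrimitive 4 (3 * Real.pi / 5) =
      5 / 2 * Real.sin (2 * Real.pi / 5) - 5 / 3 * s := by
    rw [circPrimitive_four, show 2 * (3 * Real.pi / 5) = Real.pi / 5 + Real.pi by ring,
      show 3 * (3 * Real.pi / 5) = 2 * Real.pi - Real.pi / 5 by ring,
      show 4 * (3 * Real.pi / 5) = 2 * Real.pi / 5 + 2 * Real.pi by ring,
      show 3 * Real.pi / 5 = Real.pi - 2 * Real.pi / 5 by ring, Real.sin_add_pi,
      Real.sin_two_pi_sub, Real.sin_add_two_pi, Real.sin_pi_sub]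
    ring
  -- The roots are cos(π/5) and cos(3π/5); with cos x = 0 they give the sign changes π/5, π/2 and
  -- 3π/5.
  have hquad : ∀ c : ℝ, 4 * c ^ 2 - 2 * c - 1 =
      4 * ((c - (1 + √5) / 4) * (c + (√5 - 1) / 4)) := by
    intro c
    linear_combination (1 / 4 : ℝ) * hs
  rw [integral_abs_circSymbol_add 4 0 (Real.pi / 5) Real.pi,
    integral_abs_circSymbol_add 4 (Real.pi / 5) (Real.pi / 2) Real.pi,
    integral_abs_circSymbol_add 4 (Real.pi / 2) (3 * Real.pi / 5) Real.pi,
    integral_abs_circSymbol_of_nonneg (a := 0) (by linarith) le_rfl (by linarith) fun x h1 _ => by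
      rw [c1] at h1
      rw [circSymbol_four, hquad]
      have h2 := mul_nonneg (sub_nonneg.2 h1) (by linarith : 0 ≤ Real.cos x + (√5 - 1) / 4)
      have h3 := mul_nonneg (by linarith : 0 ≤ Real.cos x) (by linarith : 0 ≤ Real.cos x + 1)
      nlinarith [mul_nonneg h3 h2],
    integral_abs_circSymbol_of_nonpos (a := Real.pi / 5) (by linarith) (by linarith) (by linarith)
      fun x h0 h1 => by
      rw [c1] at h1
      rw [Real.cos_pi_div_two] at h0
      rw [circSymbol_four, hquad]
      have h2 := mul_nonneg (sub_nonneg.2 h1) (by linarith : 0 ≤ Real.cos x + (√5 - 1) / 4)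
      have h3 := mul_nonneg (by linarith : 0 ≤ Real.cos x) (by linarith : 0 ≤ Real.cos x + 1)
      nlinarith [mul_nonneg h3 h2],
    integral_abs_circSymbol_of_nonneg (a := Real.pi / 2) (by linarith) (by linarith)
      (by linarith) fun x h0 h1 => by
      rw [c3] at h0
      rw [Real.cos_pi_div_two] at h1
      rw [circSymbol_four, hquad]
      have h2 := mul_nonneg (by linarith : 0 ≤ (1 + √5) / 4 - Real.cos x)
        (by linarith : 0 ≤ Real.cos x + (√5 - 1) / 4)
      have h3 := mul_nonneg (by linarith : 0 ≤ -Real.cos x) (by linarith : 0 ≤ Real.cos x + 1)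
      nlinarith [mul_nonneg h3 h2],
    integral_abs_circSymbol_of_nonpos (a := 3 * Real.pi / 5) (by linarith) (by linarith) le_rfl
      fun x h0 h1 => by
      rw [c3] at h1
      rw [Real.cos_pi] at h0
      rw [circSymbol_four, hquad]
      have h2 := mul_nonneg (by linarith : 0 ≤ (1 + √5) / 4 - Real.cos x)
        (by linarith : 0 ≤ -(Real.cos x + (√5 - 1) / 4))
      have h3 := mul_nonneg (by linarith : 0 ≤ -Real.cos x) (by linarith : 0 ≤ Real.cos x + 1)
      nlinarith [mul_nonneg h3 h2],
    circPrimitive_zero, circPrimitive_pi, F1, F2, F3, s2]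
  nlinarith

theorem integral_abs_circSymbol_lt {r : ℕ} (hr : r ≤ 4) :
    ∫ x in (0 : ℝ)..Real.pi, |circSymbol r x| < 2 * Real.pi := by
  interval_cases r
  · simp [circSymbol, Real.pi_pos]
  · exact integral_abs_circSymbol_one_lt
  · exact integral_abs_circSymbol_two_lt
  · exact integral_abs_circSymbol_three_lt
  · exact integral_abs_circSymbol_four_lt

/-! ### Taylor bounds for sine and cosine -/

theorem nonneg_of_hasDerivAt_nonneg {g g' : ℝ → ℝ} (h0 : 0 ≤ g 0)
    (hg : ∀ x, HasDerivAt g (g' x) x) (hg' : ∀ x, 0 ≤ x → 0 ≤ g' x) {x : ℝ} (hx : 0 ≤ x) :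
    0 ≤ g x := by
  refine h0.trans (monotoneOn_of_hasDerivWithinAt_nonneg (f' := g') (convex_Ici 0)
    (fun y _ => (hg y).continuousAt.continuousWithinAt) (fun y _ => (hg y).hasDerivWithinAt)
    (fun y hy => hg' y ?_) (Set.self_mem_Ici) hx hx)
  exact interior_subset hy

theorem Real.cos_le_one_sub_add_quartic {x : ℝ} (hx : 0 ≤ x) :
    Real.cos x ≤ 1 - x ^ 2 / 2 + x ^ 4 / 24 := by
  have h := nonneg_of_hasDerivAt_nonneg (g := fun x => 1 - x ^ 2 / 2 + x ^ 4 / 24 - Real.cos x)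
    (g' := fun x => Real.sin x - (x - x ^ 3 / 6)) (by simp) (fun x => by
      have h1 := ((((hasDerivAt_pow 2 x).div_const 2).const_sub 1).add
        ((hasDerivAt_pow 4 x).div_const 24)).sub (Real.hasDerivAt_cos x)
      refine h1.congr_deriv ?_
      norm_num
      ring) (fun x hx => by linarith [Real.sin_ge_sub_cube hx]) hx
  linarith

theorem Real.sin_le_sub_cube_add_quintic {x : ℝ} (hx : 0 ≤ x) :
    Real.sin x ≤ x - x ^ 3 / 6 + x ^ 5 / 120 := by
  have h := nonneg_of_hasDerivAt_nonneg (g := fun x => x - x ^ 3 / 6 + x ^ 5 / 120 - Real.sin x)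
    (g' := fun x => 1 - x ^ 2 / 2 + x ^ 4 / 24 - Real.cos x) (by simp) (fun x => by
      have h1 := (((hasDerivAt_id x).sub ((hasDerivAt_pow 3 x).div_const 6)).add
        ((hasDerivAt_pow 5 x).div_const 120)).sub (Real.hasDerivAt_sin x)
      refine h1.congr_deriv ?_
      norm_num
      ring) (fun x hx => by linarith [Real.cos_le_one_sub_add_quartic hx]) hx
  linarith

theorem Real.one_sub_add_quartic_sub_sextic_le_cos {x : ℝ} (hx : 0 ≤ x) :
    1 - x ^ 2 / 2 + x ^ 4 / 24 - x ^ 6 / 720 ≤ Real.cos x := by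
  have h := nonneg_of_hasDerivAt_nonneg
    (g := fun x => Real.cos x - (1 - x ^ 2 / 2 + x ^ 4 / 24 - x ^ 6 / 720))
    (g' := fun x => x - x ^ 3 / 6 + x ^ 5 / 120 - Real.sin x) (by simp) (fun x => by
      have h1 := (Real.hasDerivAt_cos x).sub (((((hasDerivAt_pow 2 x).div_const 2).const_sub 1).add
        ((hasDerivAt_pow 4 x).div_const 24)).sub ((hasDerivAt_pow 6 x).div_const 720))
      refine h1.congr_deriv ?_
      norm_num
      ring) (fun x hx => by linarith [Real.sin_le_sub_cube_add_quintic hx]) hx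
  linarith

theorem Real.sub_cube_add_quintic_sub_septic_le_sin {x : ℝ} (hx : 0 ≤ x) :
    x - x ^ 3 / 6 + x ^ 5 / 120 - x ^ 7 / 5040 ≤ Real.sin x := by
  have h := nonneg_of_hasDerivAt_nonneg
    (g := fun x => Real.sin x - (x - x ^ 3 / 6 + x ^ 5 / 120 - x ^ 7 / 5040))
    (g' := fun x => Real.cos x - (1 - x ^ 2 / 2 + x ^ 4 / 24 - x ^ 6 / 720)) (by simp) (fun x => by
      have h1 := (Real.hasDerivAt_sin x).sub ((((hasDerivAt_id x).sub
        ((hasDerivAt_pow 3 x).div_const 6)).add ((hasDerivAt_pow 5 x).div_const 120)).sub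
        ((hasDerivAt_pow 7 x).div_const 5040))
      refine h1.congr_deriv ?_
      norm_num
      ring) (fun x hx => by linarith [Real.one_sub_add_quartic_sub_sextic_le_cos hx]) hx
  linarith

/-! ### The cases r ≥ 5 -/

/-- Each sine is bounded below by its Taylor polynomial of degree 7; the polynomials in r are the
closed forms of ∑ d², ∑ d⁴ and ∑ d⁶. -/
theorem circPrimitive_ge {h : ℝ} (hh : 0 ≤ h) (r : ℕ) :
    2 * h * (r - h ^ 2 / 6 * (r * (r + 1) * (2 * r + 1) / 6) +
      h ^ 4 / 120 * (r * (r + 1) * (2 * r + 1) * (3 * r ^ 2 + 3 * r - 1) / 30) -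
      h ^ 6 / 5040 * (r * (r + 1) * (2 * r + 1) * (3 * r ^ 4 + 6 * r ^ 3 - 3 * r + 1) / 42)) ≤
      circPrimitive r h := by
  induction r with
  | zero => simp [circPrimitive]
  | succ r ih =>
    rw [circPrimitive, Finset.sum_range_succ, ← circPrimitive]
    have hr : (0 : ℝ) < r + 1 := by positivity
    have h1 := Real.sub_cube_add_quintic_sub_septic_le_sin
      (mul_nonneg hr.le hh : 0 ≤ ((r : ℝ) + 1) * h)
    have h2 := div_le_div_of_nonneg_right (mul_le_mul_of_nonneg_left h1 zero_le_two) hr.le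
    refine le_trans (le_of_eq ?_) (add_le_add ih h2)
    push_cast
    field_simp
    ring

/-- With u = 1/(r+1) and a = π², the right side is the bound of `circPrimitive_ge` at h = πu,
divided by 2π. The condition u ≤ 1/6 means r ≥ 5, and at u = 1/6 the value is only about 0.5027. -/
theorem half_lt_septic_riemannSum {u a : ℝ} (hu : 0 ≤ u) (hu6 : u ≤ 1 / 6)
    (ha : 9.8696 ≤ a) (ha' : a ≤ 9.8697) :
    1 / 2 < 1 - u - a / 6 * (1 / 3 - u / 2 + u ^ 2 / 6) +
      a ^ 2 / 120 * (1 / 5 - u / 2 + u ^ 2 / 3 - u ^ 4 / 30) -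
      a ^ 3 / 5040 * (1 / 7 - u / 2 + u ^ 2 / 2 - u ^ 4 / 6 + u ^ 6 / 42) := by
  have h2 : u ^ 2 ≤ u / 6 := by nlinarith
  have h20 : 0 ≤ u ^ 2 := sq_nonneg u
  have h40 : 0 ≤ u ^ 4 := by positivity
  have h4 : u ^ 4 ≤ u ^ 2 / 36 := by nlinarith
  have h60 : 0 ≤ u ^ 6 := by positivity
  have h6 : u ^ 6 ≤ u ^ 4 / 36 := by nlinarith
  have b1 : 0 ≤ 1 / 3 - u / 2 + u ^ 2 / 6 := by linarith
  have b2 : 0 ≤ 1 / 5 - u / 2 + u ^ 2 / 3 - u ^ 4 / 30 := by linarith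
  have b3 : 0 ≤ 1 / 7 - u / 2 + u ^ 2 / 2 - u ^ 4 / 6 + u ^ 6 / 42 := by linarith
  have a2 : 97.409 ≤ a ^ 2 := by nlinarith
  have a3 : a ^ 3 ≤ 961.42 := by
    calc a ^ 3 ≤ 9.8697 ^ 3 := by gcongr
      _ ≤ 961.42 := by norm_num
  have m1 := mul_le_mul_of_nonneg_right ha' b1
  have m2 := mul_le_mul_of_nonneg_right a2 b2
  have m3 := mul_le_mul_of_nonneg_right a3 b3
  linarith

theorem pi_lt_circPrimitive {r : ℕ} (hr : 5 ≤ r) :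
    Real.pi < circPrimitive r (Real.pi / (r + 1)) := by
  have hpi := Real.pi_pos
  have hr' : (5 : ℝ) ≤ r := by exact_mod_cast hr
  have hn : (0 : ℝ) < (r : ℝ) + 1 := by positivity
  refine lt_of_lt_of_le ?_ (circPrimitive_ge (by positivity) r)
  have hq := half_lt_septic_riemannSum (u := 1 / ((r : ℝ) + 1)) (a := Real.pi ^ 2)
    (by positivity) (by gcongr; linarith)
    (by nlinarith [Real.pi_gt_d6]) (by nlinarith [Real.pi_lt_d6])
  have h1 := mul_lt_mul_of_pos_left hq (by positivity : 0 < 2 * Real.pi)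
  calc Real.pi = 2 * Real.pi * (1 / 2) := by ring
    _ < _ := h1
    _ = _ := by
      field_simp
      ring

theorem two_pi_lt_integral_abs_circSymbol {r : ℕ} (hr : 5 ≤ r) :
    2 * Real.pi < ∫ x in (0 : ℝ)..Real.pi, |circSymbol r x| := by
  have hpi := Real.pi_pos
  refine lt_of_lt_of_le (mul_lt_mul_of_pos_left (pi_lt_circPrimitive hr) two_pos)
    (two_mul_circPrimitive_le_integral_abs (by positivity) ?_)
  exact div_le_self hpi.le (by linarith [(Nat.cast_nonneg r : (0 : ℝ) ≤ r)])

/-! ### Conclusion -/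

theorem mainTheorem2 :
    {p : ℕ × ℕ | p.1 ≤ 4 ∧ 1 ≤ p.2 ∧ p.1 ≤ p.2 / 2 ∧ (circG p.1 p.2).Hyperenergetic}.Finite ∧
    ∀ r : ℕ, 5 ≤ r →
      {N : ℕ | r ≤ N / 2 ∧ ¬ (circG r N).Hyperenergetic}.Finite ∧
      ¬ (circG r (2 * r + 2)).Hyperenergetic := by
  refine ⟨?_, fun r hr => ⟨?_, circG_not_hyperenergetic_two_mul_add_two r⟩⟩
  · have h : ∀ r ∈ Set.Iic 4, {N : ℕ | (circG r N).Hyperenergetic}.Finite := by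
      intro r hr
      have h1 := eventually_not_hyperenergetic (integral_abs_circSymbol_lt hr)
      rw [← Nat.cofinite_eq_atTop, Filter.eventually_cofinite] at h1
      simpa using h1
    refine ((Set.finite_Iic 4).biUnion fun r hr => (h r hr).image (Prod.mk r)).subset ?_
    rintro ⟨r, N⟩ ⟨hr, -, -, hN⟩
    exact Set.mem_biUnion hr ⟨N, hN, rfl⟩
  · have h1 := eventually_hyperenergetic (two_pi_lt_integral_abs_circSymbol hr)
    rw [← Nat.cofinite_eq_atTop, Filter.eventually_cofinite] at h1
    exact h1.subset fun N hN => hN.2
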